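/- Let $n,r\ge 0$ be integers, and let $q$, $z$ and $x_1,\dots,x_n$ be indeterminates (or, more generally, elements of a field such that $q$ and the $x_i$ are nonzero and no denominator below vanishes, where in the series only the terms with $i\le r$ are considered, the later ones being zero). Write $(a;q)_k=\prod_{i=0}^{k-1}(1-aq^i)$ for $k\ge0$, $(a;q)_{-m}=1/(aq^{-m};q)_m$ for $m>0$, and $${}_{s+1}\phi_s\left[\begin{matrix}a_1,\dots,a_{s+1}\\ b_1,\dots,b_s\end{matrix};q,w\right]=\sum_{i\ge0}\frac{(a_1;q)_i\cdots(a_{s+1};q)_i}{(b_1;q)_i\cdots(b_s;q)_i}\,\frac{w^i}{(q;q)_i}.$$ Then $$\sum_{\sigma\in\{-1,+1\}^n}\ \prod_{i=1}^n\frac{1-qx_i^{2\sigma_i}}{1-x_i^{2\sigma_i}}\,\frac{1-q^rzx_i^{-\sigma_i}}{1-zx_i^{-\sigma_i}}\ \prod_{1\le i<j\le n}\frac{1-qx_i^{\sigma_i}x_j^{\sigma_j}}{1-x_i^{\sigma_i}x_j^{\sigma_j}}$$ $$=q^{nr-\binom r2}\,(-q;q)_{n-r}\,\frac{(qz^2;q^2)_r}{(qz^2;q)_r}\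 {}_{2n+4}\phi_{2n+3}\left[\begin{matrix}z^2,\,qz,\,-qz,\,q^{-r},\,\{qzx_i,\,qz/x_i\}_{1\le i\le n}\\ z,\,-z,\,q^{r+1}z^2,\,\{zx_i,\,z/x_i\}_{1\le i\le n}\end{matrix};q,-q^{r-n}\right].$$ The series on the right terminates (its terms with $i>r$ are zero) and is very-well-poised: when each $qzx_i$ is paired with $z/x_i$ and each $qz/x_i$ with $zx_i$, and $qz$, $-qz$, $q^{-r}$ are paired with $z$, $-z$, $q^{r+1}z^2$, the product of every pair equals $q\cdot z^2$, where $z^2$ is the first upper parameter, and the next two upper parameters are $\pm q$ times its square root $z$. -/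

import Mathlib

/-- The `q`-shifted factorial `(a;q)_k = (1 - a)(1 - a q) ⋯ (1 - a q^(k-1))` for a natural
number `k`. -/
def qPoch {K : Type*} [Field K] (a q : K) (k : ℕ) : K :=
  ∏ i ∈ Finset.range k, (1 - a * q ^ i)

/-- The `q`-shifted factorial with an integer index: `(a;q)_k` is the product above for `k ≥ 0`,
and `(a;q)_{-m} = 1 / (a q^{-m};q)_m` for `m > 0`. -/
def qPochInt {K : Type*} [Field K] (a q : K) : ℤ → K
  | Int.ofNat k => qPoch a q k
  | Int.negSucc k => (qPoch (a * q ^ (-((k : ℤ) + 1))) q (k + 1))⁻¹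

/-- The `m`-th term of the series `_{s+1}φ_s` with upper parameters `a`, lower parameters `b`,
base `q` and argument `w`. -/
def qHypTerm {K : Type*} [Field K] {s : ℕ} (a : Fin (s + 1) → K) (b : Fin s → K) (q w : K)
    (m : ℕ) : K :=
  (∏ i, qPoch (a i) q m) / (∏ i, qPoch (b i) q m) * (w ^ m / qPoch q q m)

/-- The basic hypergeometric series `_{s+1}φ_s [a; b; q, w]`. -/
noncomputable def qHyp {K : Type*} [Field K] [TopologicalSpace K] {s : ℕ}
    (a : Fin (s + 1) → K) (b : Fin s → K) (q w : K) : K :=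
  ∑' m : ℕ, qHypTerm a b q w m

/-- `_{s+3}φ_{s+2} [a; b; q, ·]` is very-well-poised: writing `a = (a₁, …, a_{s+3})` and
`b = (b₁, …, b_{s+2})`, one has `q a₁ = a₂ b₁ = a₃ b₂ = ⋯ = a_{s+3} b_{s+2}` and
`a₂ = q c`, `a₃ = -q c` for a square root `c` of `a₁`. -/
def IsVeryWellPoised {K : Type*} [Field K] {s : ℕ} (a : Fin (s + 3) → K) (b : Fin (s + 2) → K)
    (q : K) : Prop :=
  (∀ i : Fin (s + 2), a i.succ * b i = q * a 0) ∧
    ∃ c : K, c ^ 2 = a 0 ∧ a 1 = q * c ∧ a 2 = -(q * c)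

/-- The upper parameters `z², qz, -qz, q^{-r}, {q z x_i}, {q z / x_i}`, which are `2n + 4` in
number. -/
def upperParams {K : Type*} [Field K] {n : ℕ} (r : ℕ) (x : Fin n → K) (z q : K) :
    Fin (n + n + 1 + 3) → K :=
  Matrix.vecCons (z ^ 2) (Matrix.vecCons (q * z) (Matrix.vecCons (-(q * z))
    (Matrix.vecCons (q ^ (-(r : ℤ)))
      (Fin.append (fun i => q * z * x i) (fun i => q * z / x i)))))

/-- The lower parameters `z, -z, q^{r+1} z², {z / x_i}, {z x_i}`, which are `2n + 3` in number
(each is listed at the place of the upper parameter with which it is paired). -/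
def lowerParams {K : Type*} [Field K] {n : ℕ} (r : ℕ) (x : Fin n → K) (z q : K) :
    Fin (n + n + 1 + 2) → K :=
  Matrix.vecCons z (Matrix.vecCons (-z) (Matrix.vecCons (q ^ (r + 1) * z ^ 2)
    (Fin.append (fun i => z / x i) (fun i => z * x i))))

/-- The sum over all sign vectors `σ ∈ {-1, +1}^n` of
`∏_i (1 - q x_i^{2σ_i}) / (1 - x_i^{2σ_i}) * (1 - q^r z x_i^{-σ_i}) / (1 - z x_i^{-σ_i})`
times `∏_{i<j} (1 - q x_i^{σ_i} x_j^{σ_j}) / (1 - x_i^{σ_i} x_j^{σ_j})`. -/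
def signSum {K : Type*} [Field K] {n : ℕ} (r : ℕ) (x : Fin n → K) (z q : K) : K :=
  ∑ σ : Fin n → ℤˣ,
    (∏ i, ((1 - q * x i ^ (2 * (σ i : ℤ))) / (1 - x i ^ (2 * (σ i : ℤ))) *
        ((1 - q ^ r * z * x i ^ (-(σ i : ℤ))) / (1 - z * x i ^ (-(σ i : ℤ)))))) *
      ∏ i, ∏ j ∈ Finset.Ioi i,
        ((1 - q * x i ^ (σ i : ℤ) * x j ^ (σ j : ℤ)) / (1 - x i ^ (σ i : ℤ) * x j ^ (σ j : ℤ)))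

/-!
Multiply the sum over signs by `∏ i, (1 - z x_i) (1 - z / x_i)` and call the result `S`. Viewed as
a function of one variable `t`, with the others `x_i` fixed, its poles at `t = ±1` and
`t = x_i ^ (±1)` cancel between the two terms with opposite sign of `t` (or of `x_i`), so `S` is a
Laurent polynomial, affine in `t + 1 / t`. It is therefore determined by its behaviour at `t = 0`
and its value at `t = z`; there it reduces to the sums with one variable fewer, with parameters
`(z, r)` and `(q z, r - 1)`. The expansion `∑ m, c_m ∏ i, (1 - z q^m x_i) (1 - z q^m / x_i)` into
which the right-hand side turns satisfies the same two recursions, and without variables the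
identity is a very-well-poised sum that telescopes in `r`.

Induction needs more nonvanishing than the theorem grants, so this is done for indeterminates;
the identity is then specialized, all denominators that occur being nonzero at the special point.
-/

open Finset
open Matrix (vecCons vecHead vecTail)

section QPochhammer

variable {K : Type*} [Field K] {a q : K}

theorem qPoch_zero (a q : K) : qPoch a q 0 = 1 :=
  Finset.prod_range_zero _

theorem qPoch_succ (a q : K) (k : ℕ) : qPoch a q (k + 1) = qPoch a q k * (1 - a * q ^ k) :=
  Finset.prod_range_succ _ _

theorem qPoch_add (a q : K) (k l : ℕ) :
    qPoch a q (k + l) = qPoch a q k * qPoch (a * q ^ k) q l := by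
  simp only [qPoch, prod_range_add, pow_add, mul_assoc]

theorem qPoch_succ' (a q : K) (k : ℕ) : qPoch a q (k + 1) = (1 - a) * qPoch (q * a) q k := by
  rw [add_comm, qPoch_add, qPoch_succ, qPoch_zero, pow_zero, pow_one, mul_one, one_mul, mul_comm q]

theorem qPoch_ne_zero {k : ℕ} (h : ∀ i < k, a * q ^ i ≠ 1) : qPoch a q k ≠ 0 :=
  prod_ne_zero_iff.2 fun i hi ↦ sub_ne_zero.2 (h i (mem_range.1 hi)).symm

theorem qPoch_ne_zero_of_le {k l : ℕ} (hkl : k ≤ l) (h : qPoch a q l ≠ 0) : qPoch a q k ≠ 0 := by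
  rw [← Nat.add_sub_cancel' hkl, qPoch_add] at h
  exact left_ne_zero_of_mul h

theorem qPoch_mul_div_qPoch (h : ∀ i : ℕ, a * q ^ i ≠ 1) (k : ℕ) :
    qPoch (q * a) q k / qPoch a q k = (1 - a * q ^ k) / (1 - a) := by
  have ha : 1 - a ≠ 0 := sub_ne_zero.2 (by simpa using (h 0).symm)
  rw [div_eq_div_iff (qPoch_ne_zero fun i _ ↦ h i) ha, mul_comm, ← qPoch_succ', qPoch_succ,
    mul_comm]

theorem qPoch_zpow_neg_eq_zero (hq : q ≠ 0) {r m : ℕ} (h : r < m) :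
    qPoch (q ^ (-(r : ℤ))) q m = 0 :=
  prod_eq_zero (mem_range.2 h) (by simp [hq])

theorem qPoch_zpow_neg_mul_pow (hq : q ≠ 0) (r m : ℕ) :
    qPoch (q ^ (-(r : ℤ))) q m * (-q ^ r) ^ m = ∏ i ∈ range m, (q ^ i - q ^ r) := by
  rw [qPoch, ← card_range m, ← prod_const, card_range, ← prod_mul_distrib]
  refine prod_congr rfl fun i _ ↦ ?_
  rw [zpow_neg, zpow_natCast]
  field_simp
  ring

theorem qPochInt_neg_natCast (a q : K) (k : ℕ) :
    qPochInt a q (-(k : ℤ)) = (qPoch (a * q ^ (-(k : ℤ))) q k)⁻¹ := by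
  cases k with
  | zero => simp [qPochInt, qPoch_zero]
  | succ k => rfl

theorem qPochInt_add_one (hq : q ≠ 0) (h : ∀ d : ℤ, a * q ^ d ≠ 1) (d : ℤ) :
    qPochInt a q (d + 1) = qPochInt a q d * (1 - a * q ^ d) := by
  obtain ⟨k, rfl | rfl⟩ := d.eq_nat_or_neg
  · rw [zpow_natCast]
    exact qPoch_succ a q k
  · cases k with
    | zero => simp [qPochInt, qPoch_zero, qPoch_succ]
    | succ k =>
      have hne : 1 - a * q ^ (-((k + 1 : ℕ) : ℤ)) ≠ 0 := sub_ne_zero.2 (h _).symm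
      have hd : -((k + 1 : ℕ) : ℤ) + 1 = -(k : ℤ) := by push_cast; ring
      have hshift : q * (a * q ^ (-((k + 1 : ℕ) : ℤ))) = a * q ^ (-(k : ℤ)) := by
        rw [← hd, zpow_add_one₀ hq]; ring
      rw [hd, qPochInt_neg_natCast, qPochInt_neg_natCast, qPoch_succ', hshift]
      field_simp

end QPochhammer

section PoisedWeight

variable {K : Type*} [Field K] {a q : K}

/-- The terms of the very-well-poised `₄φ₃` series with first parameter `a` (the case `n = 0` of
the theorem), normalized so that their sum over `m ≤ r` is `1`. -/
noncomputable def poisedWeight (a q : K) (r m : ℕ) : K :=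
  qPoch (q * a) (q ^ 2) r * (1 - a * q ^ (2 * m)) * (∏ i ∈ range m, (q ^ i - q ^ r)) /
    (qPoch (-1) q r * qPoch (a * q ^ m) q (r + 1) * qPoch q q m)

theorem prod_range_pow_sub_pow_eq_zero (q : K) {r m : ℕ} (h : r < m) :
    ∏ i ∈ range m, (q ^ i - q ^ r) = 0 :=
  prod_eq_zero (mem_range.2 h) (sub_self _)

theorem prod_range_succ_pow_sub_pow_succ (q : K) (r m : ℕ) :
    ∏ i ∈ range (m + 1), (q ^ i - q ^ (r + 1)) =
      (1 - q ^ (r + 1)) * q ^ m * ∏ i ∈ range m, (q ^ i - q ^ r) := by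
  have hq : ∀ i, q ^ (i + 1) - q ^ (r + 1) = q * (q ^ i - q ^ r) := fun i ↦ by ring
  simp only [prod_range_succ', hq, prod_mul_distrib, prod_const, card_range, pow_zero]
  ring

theorem poisedWeight_succ_succ {r m : ℕ} (hneg : 1 + q ^ r ≠ 0) (hroot : q ^ (m + 1) ≠ 1)
    (ha : a * q ^ (m + 1) ≠ 1) :
    (1 + q ^ r) * (1 - a * q ^ (m + 1)) * (1 - q ^ (m + 1)) * poisedWeight a q (r + 1) (m + 1) =
      q ^ m * (1 - q * a) * (1 - q ^ (r + 1)) * poisedWeight (q ^ 2 * a) q r m := by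
  have hroot' : 1 - q ^ (m + 1) ≠ 0 := sub_ne_zero.2 hroot.symm
  have ha' : 1 - a * q ^ (m + 1) ≠ 0 := sub_ne_zero.2 ha.symm
  rw [poisedWeight, poisedWeight, prod_range_succ_pow_sub_pow_succ, qPoch_succ' (q * a),
    qPoch_succ (-1), qPoch_succ' (a * q ^ (m + 1)), qPoch_succ q,
    show q ^ 2 * (q * a) = q * (q ^ 2 * a) by ring,
    show q * (a * q ^ (m + 1)) = q ^ 2 * a * q ^ m by ring,
    show a * q ^ (2 * (m + 1)) = q ^ 2 * a * q ^ (2 * m) by ring,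
    show 1 - -1 * q ^ r = 1 + q ^ r by ring, ← pow_succ' q m]
  field_simp

/-- The telescoping certificate for `poisedWeight` in the direction of `r`. -/
noncomputable def poisedCert (a q : K) (r m : ℕ) : K :=
  qPoch (q * a) (q ^ 2) r * q ^ r * (1 - a * q ^ (2 * m + 1)) *
    (∏ i ∈ range m, (q ^ i - q ^ r)) /
      (qPoch (-1) q (r + 1) * qPoch (a * q ^ (m + 1)) q (r + 1) * qPoch q q m)

theorem poisedWeight_succ_sub_zero (hneg : ∀ k : ℕ, 1 + q ^ k ≠ 0) (ha : ∀ k : ℕ, a * q ^ k ≠ 1)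
    (r : ℕ) : poisedWeight a q (r + 1) 0 - poisedWeight a q r 0 = -poisedCert a q r 0 := by
  have ha' : ∀ k, 1 - a * q ^ k ≠ 0 := fun k ↦ sub_ne_zero.2 (ha k).symm
  have hpoch : qPoch (q * a) q r ≠ 0 := qPoch_ne_zero fun i _ ↦ by
    rw [mul_right_comm, mul_comm _ a, ← pow_succ']
    exact ha _
  have hneg' : qPoch (-1) q r ≠ 0 := qPoch_ne_zero fun i _ h ↦ hneg i (by linear_combination -h)
  have h₀ := ha' 0
  have h₁ := ha' (r + 1)
  have h₂ := hneg r
  simp only [poisedWeight, poisedCert, range_zero, prod_empty, qPoch_zero, mul_zero, zero_add,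
    pow_zero, mul_one, pow_one]
  rw [mul_comm a q, qPoch_succ' a q (r + 1), qPoch_succ' a q r, qPoch_succ (q * a) q r,
    qPoch_succ (-1), qPoch_succ (q * a) (q ^ 2), show q * a * q ^ r = a * q ^ (r + 1) by ring,
    show 1 - -1 * q ^ r = 1 + q ^ r by ring]
  rw [pow_zero, mul_one] at h₀
  field_simp
  ring

theorem poisedWeight_succ_sub_succ (hneg : ∀ k : ℕ, 1 + q ^ k ≠ 0)
    (hroot : ∀ k : ℕ, q ^ (k + 1) ≠ 1) (ha : ∀ k : ℕ, a * q ^ k ≠ 1) (r m : ℕ) :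
    poisedWeight a q (r + 1) (m + 1) - poisedWeight a q r (m + 1) =
      poisedCert a q r m - poisedCert a q r (m + 1) := by
  have ha' : ∀ k, 1 - a * q ^ k ≠ 0 := fun k ↦ sub_ne_zero.2 (ha k).symm
  have hpoch : qPoch (a * q ^ (m + 2)) q r ≠ 0 := qPoch_ne_zero fun i _ ↦ by
    rw [mul_assoc, ← pow_add]
    exact ha _
  have hneg' : qPoch (-1) q r ≠ 0 := qPoch_ne_zero fun i _ h ↦ hneg i (by linear_combination -h)
  have hq' : qPoch q q m ≠ 0 := qPoch_ne_zero fun i _ ↦ by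
    rw [← pow_succ']
    exact hroot i
  have h₀ := ha' (m + 1)
  have h₁ := ha' (m + 2 + r)
  have h₂ := hneg r
  have h₃ : 1 - q ^ (m + 1) ≠ 0 := sub_ne_zero.2 (hroot m).symm
  simp only [poisedWeight, poisedCert]
  rw [prod_range_succ_pow_sub_pow_succ, prod_range_succ, qPoch_succ' (a * q ^ (m + 1)) q (r + 1),
    qPoch_succ' (a * q ^ (m + 1)) q r, show q * (a * q ^ (m + 1)) = a * q ^ (m + 2) by ring,
    qPoch_succ (a * q ^ (m + 2)), show a * q ^ (m + 2) * q ^ r = a * q ^ (m + 2 + r) by ring,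
    qPoch_succ (-1), show 1 - -1 * q ^ r = 1 + q ^ r by ring, qPoch_succ q, ← pow_succ' q m,
    qPoch_succ (q * a)]
  field_simp
  ring

theorem sum_range_poisedWeight_succ_sub (hneg : ∀ k : ℕ, 1 + q ^ k ≠ 0)
    (hroot : ∀ k : ℕ, q ^ (k + 1) ≠ 1) (ha : ∀ k : ℕ, a * q ^ k ≠ 1) (r m : ℕ) :
    ∑ k ∈ range (m + 1), (poisedWeight a q (r + 1) k - poisedWeight a q r k) =
      -poisedCert a q r m := by
  rw [sum_range_succ', sum_congr rfl fun k _ ↦ poisedWeight_succ_sub_succ hneg hroot ha r k,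
    sum_range_sub', poisedWeight_succ_sub_zero hneg ha]
  ring

theorem sum_range_poisedWeight (hneg : ∀ k : ℕ, 1 + q ^ k ≠ 0)
    (hroot : ∀ k : ℕ, q ^ (k + 1) ≠ 1) (ha : ∀ k : ℕ, a * q ^ k ≠ 1) (r : ℕ) :
    ∑ m ∈ range (r + 1), poisedWeight a q r m = 1 := by
  induction r with
  | zero =>
    have : 1 - a ≠ 0 := sub_ne_zero.2 (by simpa using (ha 0).symm)
    simp [poisedWeight, qPoch_zero, qPoch_succ, this]
  | succ r ih =>
    have hsub := sum_range_poisedWeight_succ_sub hneg hroot ha r (r + 1)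
    have hcert : poisedCert a q r (r + 1) = 0 := by
      simp [poisedCert, prod_range_pow_sub_pow_eq_zero q r.lt_succ_self]
    have hlast : poisedWeight a q r (r + 1) = 0 := by
      simp [poisedWeight, prod_range_pow_sub_pow_eq_zero q r.lt_succ_self]
    rw [sum_sub_distrib, sum_range_succ (poisedWeight a q r), ih, hcert, hlast] at hsub
    linear_combination hsub

end PoisedWeight

section SignVectors

variable {K ι κ : Type*} [Field K]

/-- The point `(x_i ^ σ_i)_i` attached to a sign vector `σ`. -/
def signPow (x : ι → K) (σ : ι → ℤˣ) (i : ι) : K :=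
  x i ^ (σ i : ℤ)

/-- Regular points: those at which no denominator `1 - x_i ^ (±2)` or `1 - x_i ^ (±1) x_j ^ (±1)`
of the sum over signs vanishes. -/
structure SignRegular (x : ι → K) : Prop where
  ne_zero : ∀ i, x i ≠ 0
  sq_ne_one : ∀ i, x i ^ 2 ≠ 1
  mul_ne_one : Pairwise fun i j ↦ x i * x j ≠ 1
  injective : Function.Injective x

variable {x : ι → K}

theorem signPow_eq_or (x : ι → K) (σ : ι → ℤˣ) (i : ι) :
    signPow x σ i = x i ∨ signPow x σ i = (x i)⁻¹ := by
  rcases Int.units_eq_one_or (σ i) with h | h <;> simp [signPow, h]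

theorem signPow_update_neg [DecidableEq ι] (x : ι → K) (σ : ι → ℤˣ) (k : ι) :
    signPow x (Function.update σ k (-σ k)) =
      Function.update (signPow x σ) k (signPow x σ k)⁻¹ := by
  ext i
  obtain rfl | hi := eq_or_ne i k
  · simp [signPow, zpow_neg]
  · simp [signPow, hi]

theorem signPow_vecCons {n : ℕ} (t : K) (x : Fin n → K) (s : ℤˣ) (σ : Fin n → ℤˣ) :
    signPow (vecCons t x) (vecCons s σ) = vecCons (t ^ (s : ℤ)) (signPow x σ) := by
  ext i
  cases i using Fin.cases <;> rfl

theorem SignRegular.comp (hx : SignRegular x) {f : κ → ι} (hf : Function.Injective f) :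
    SignRegular (x ∘ f) where
  ne_zero i := hx.ne_zero (f i)
  sq_ne_one i := hx.sq_ne_one (f i)
  mul_ne_one _ _ hij := hx.mul_ne_one (hf.ne hij)
  injective := hx.injective.comp hf

theorem SignRegular.signPow (hx : SignRegular x) (σ : ι → ℤˣ) : SignRegular (signPow x σ) where
  ne_zero i := zpow_ne_zero _ (hx.ne_zero i)
  sq_ne_one i := by
    rcases signPow_eq_or x σ i with h | h <;> simpa [h] using hx.sq_ne_one i
  mul_ne_one i j hij := by
    have hmul := hx.mul_ne_one hij
    have hne := hx.injective.ne hij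
    rcases signPow_eq_or x σ i with hi | hi <;> rcases signPow_eq_or x σ j with hj | hj <;>
      simp only [hi, hj]
    · exact hmul
    · rwa [ne_eq, mul_inv_eq_one₀ (hx.ne_zero j)]
    · rwa [ne_eq, inv_mul_eq_one₀ (hx.ne_zero i)]
    · rwa [← mul_inv, ne_eq, inv_eq_one]
  injective i j hij := by
    by_contra hne
    have hmul := hx.mul_ne_one hne
    rcases signPow_eq_or x σ i with hi | hi <;> rcases signPow_eq_or x σ j with hj | hj <;>
      rw [hi, hj] at hij
    · exact hne (hx.injective hij)
    · exact hmul (by rw [hij, inv_mul_cancel₀ (hx.ne_zero j)])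
    · exact hmul (by rw [← hij, mul_inv_cancel₀ (hx.ne_zero i)])
    · exact hne (hx.injective (inv_injective hij))

theorem sum_signs_vecCons {n : ℕ} (f : (Fin (n + 1) → ℤˣ) → K) :
    ∑ σ, f σ = ∑ τ, (f (vecCons 1 τ) + f (vecCons (-1) τ)) := by
  have huniv : (univ : Finset ℤˣ) = {1, -1} := rfl
  rw [← (Fin.consEquiv fun _ ↦ ℤˣ).sum_comp, Fintype.sum_prod_type, huniv, sum_pair (by decide),
    ← sum_add_distrib]
  rfl

end SignVectors

section SignTerm

variable {K : Type*} [Field K] {n : ℕ}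

theorem prod_Ioi_succAbove {M : Type*} [CommMonoid M] {f : Fin (n + 1) → Fin (n + 1) → M}
    (hf : ∀ i j, f i j = f j i) (k : Fin (n + 1)) :
    ∏ i, ∏ j ∈ Ioi i, f i j =
      (∏ j, f k (k.succAbove j)) * ∏ i, ∏ j ∈ Ioi i, f (k.succAbove i) (k.succAbove j) := by
  have hite : ∀ {p : ℕ} (g : Fin p → Fin p → M),
      ∏ i, ∏ j ∈ Ioi i, g i j = ∏ i, ∏ j, if i < j then g i j else 1 := fun g ↦
    prod_congr rfl fun i _ ↦ by rw [← prod_filter, filter_lt_eq_Ioi]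
  rw [hite, hite, Fin.prod_univ_succAbove _ k]
  simp only [Fin.prod_univ_succAbove _ k, lt_irrefl, if_false, one_mul,
    (Fin.strictMono_succAbove k).lt_iff_lt, prod_mul_distrib]
  rw [← mul_assoc, ← prod_mul_distrib]
  congr 1
  refine prod_congr rfl fun j _ ↦ ?_
  rcases lt_or_gt_of_ne (Fin.succAbove_ne k j) with h | h
  · simp [h, h.not_gt, hf k]
  · simp [h, h.not_gt]

/-- The summand of `signSum` times `∏ i, (1 - z x_i) (1 - z / x_i)`, as a function of
`u_i = x_i ^ σ_i`; here `Z` stands for `q ^ r z`. -/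
def signTerm (q z Z : K) (u : Fin n → K) : K :=
  (∏ i, ((1 - q * u i ^ 2) / (1 - u i ^ 2) * ((1 - Z / u i) * (1 - z * u i)))) *
    ∏ i, ∏ j ∈ Ioi i, (1 - q * u i * u j) / (1 - u i * u j)

/-- The factors of `signTerm` which involve a distinguished variable `t`, the other variables
being `u`. -/
def varWeight (q z Z t : K) (u : Fin n → K) : K :=
  (1 - q * t ^ 2) / (1 - t ^ 2) * ((1 - Z / t) * (1 - z * t)) *
    ∏ j, (1 - q * t * u j) / (1 - t * u j)

theorem signTerm_eq_varWeight_mul (q z Z : K) (u : Fin (n + 1) → K) (k : Fin (n + 1)) :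
    signTerm q z Z u = varWeight q z Z (u k) (k.removeNth u) * signTerm q z Z (k.removeNth u) := by
  have hsymm : ∀ i j, (1 - q * u i * u j) / (1 - u i * u j) =
      (1 - q * u j * u i) / (1 - u j * u i) := fun i j ↦ by
    rw [mul_right_comm, mul_comm (u i)]
  rw [signTerm, prod_Ioi_succAbove hsymm k, Fin.prod_univ_succAbove _ k]
  simp only [varWeight, signTerm, Fin.removeNth]
  ring

/-- The sum over signs multiplied by `∏ i, (1 - z x_i) (1 - z / x_i)`. -/
def clearedSum (q z Z : K) (x : Fin n → K) : K :=
  ∑ σ, signTerm q z Z (signPow x σ)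

theorem clearedSum_vecCons (q z Z t : K) (x : Fin n → K) :
    clearedSum q z Z (vecCons t x) =
      ∑ τ, (varWeight q z Z t (signPow x τ) + varWeight q z Z t⁻¹ (signPow x τ)) *
        signTerm q z Z (signPow x τ) := by
  rw [clearedSum, sum_signs_vecCons]
  refine sum_congr rfl fun τ _ ↦ ?_
  rw [signPow_vecCons, signPow_vecCons, signTerm_eq_varWeight_mul _ _ _ _ 0,
    signTerm_eq_varWeight_mul _ _ _ (vecCons _ _) 0, add_mul, Units.val_one, zpow_one,
    Units.val_neg, Units.val_one, zpow_neg_one]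
  rfl

end SignTerm

section PairNumerator

open Polynomial

variable {K : Type*} [Field K] {q z Z t : K} {n : ℕ} {u : Fin n → K}

/-- The common denominator `(1 - t²) ∏ j, (1 - u_j t) (1 - t / u_j)` of the weights `varWeight` at
`t` and `t⁻¹`. It does not change when some `u_j` are inverted. -/
noncomputable def symDen (u : Fin n → K) : K[X] :=
  (1 - X ^ 2) * ∏ j, ((1 - C (u j) * X) * (1 - C (u j)⁻¹ * X))

/-- The numerator of `varWeight` at `t` over the denominator `t * symDen u`. -/
noncomputable def weightNum (q z Z : K) (u : Fin n → K) : K[X] :=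
  (1 - C q * X ^ 2) * (X - C Z) * (1 - C z * X) *
    ∏ j, ((1 - C (q * u j) * X) * (1 - C (u j)⁻¹ * X))

/-- The reciprocal polynomial of `weightNum`, which is up to sign the numerator of `varWeight` at
`t⁻¹` over the denominator `t * symDen u`. -/
noncomputable def weightNumRev (q z Z : K) (u : Fin n → K) : K[X] :=
  (X ^ 2 - C q) * (1 - C Z * X) * (X - C z) *
    ∏ j, ((C q - C (u j)⁻¹ * X) * (1 - C (u j) * X))

/-- The numerator of the sum of `varWeight` at `t` and at `t⁻¹` over the denominator
`t * symDen u`. -/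
noncomputable def pairNum (q z Z : K) (u : Fin n → K) : K[X] :=
  weightNum q z Z u - weightNumRev q z Z u

theorem symDen_signPow (x : Fin n → K) (σ : Fin n → ℤˣ) : symDen (signPow x σ) = symDen x := by
  refine congrArg ((1 - X ^ 2) * ·) (prod_congr rfl fun j _ ↦ ?_)
  rcases signPow_eq_or x σ j with h | h <;> rw [h]
  rw [inv_inv, mul_comm]

theorem eval_symDen_eq_neg (ht : t ≠ 0) (hu : ∀ j, u j ≠ 0) :
    (symDen u).eval t = -(t ^ (2 * n + 2) * (symDen u).eval t⁻¹) := by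
  have hprod : ∏ j, ((1 - u j * t) * (1 - (u j)⁻¹ * t)) =
      t ^ (2 * n) * ∏ j, ((1 - u j * t⁻¹) * (1 - (u j)⁻¹ * t⁻¹)) := by
    rw [pow_mul, ← Fin.prod_const, ← prod_mul_distrib]
    refine prod_congr rfl fun j _ ↦ ?_
    have := hu j
    field_simp
    ring
  simp only [symDen, eval_mul, eval_sub, eval_one, eval_pow, eval_X, eval_prod, eval_C, hprod]
  field_simp
  ring

theorem eval_weightNumRev (ht : t ≠ 0) (hu : ∀ j, u j ≠ 0) :
    (weightNumRev q z Z u).eval t = t ^ (2 * n + 4) * (weightNum q z Z u).eval t⁻¹ := by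
  have hprod : ∏ j, ((q - (u j)⁻¹ * t) * (1 - u j * t)) =
      t ^ (2 * n) * ∏ j, ((1 - q * u j * t⁻¹) * (1 - (u j)⁻¹ * t⁻¹)) := by
    rw [pow_mul, ← Fin.prod_const, ← prod_mul_distrib]
    refine prod_congr rfl fun j _ ↦ ?_
    have := hu j
    field_simp
    ring
  simp only [weightNum, weightNumRev, eval_mul, eval_sub, eval_one, eval_pow, eval_X, eval_prod,
    eval_C, hprod]
  field_simp
  ring

theorem eval_pairNum_eq_neg (ht : t ≠ 0) (hu : ∀ j, u j ≠ 0) :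
    (pairNum q z Z u).eval t = -(t ^ (2 * n + 4) * (pairNum q z Z u).eval t⁻¹) := by
  rw [pairNum, eval_sub, eval_sub, eval_weightNumRev ht hu, eval_weightNumRev (inv_ne_zero ht) hu,
    inv_inv, inv_pow]
  field_simp
  ring

theorem eval_weightNum_eq_varWeight_mul (ht : t ≠ 0) (ht2 : t ^ 2 ≠ 1)
    (htu : ∀ j, t * u j ≠ 1) :
    (weightNum q z Z u).eval t = varWeight q z Z t u * (t * (symDen u).eval t) := by
  have ht2' : 1 - t ^ 2 ≠ 0 := sub_ne_zero.2 ht2.symm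
  have hprod : ∏ j, ((1 - q * u j * t) * (1 - (u j)⁻¹ * t)) =
      (∏ j, (1 - q * t * u j) / (1 - t * u j)) * ∏ j, ((1 - u j * t) * (1 - (u j)⁻¹ * t)) := by
    rw [← prod_mul_distrib]
    refine prod_congr rfl fun j _ ↦ ?_
    have : 1 - t * u j ≠ 0 := sub_ne_zero.2 (htu j).symm
    rw [← mul_assoc, mul_comm (u j) t, div_mul_cancel₀ _ this, mul_right_comm]
  simp only [weightNum, symDen, varWeight, eval_mul, eval_sub, eval_one, eval_pow, eval_X,
    eval_prod, eval_C, hprod]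
  field_simp

theorem eval_weightNumRev_eq_varWeight_inv_mul (ht : t ≠ 0) (ht2 : t ^ 2 ≠ 1)
    (hu : ∀ j, u j ≠ 0) (htu : ∀ j, t ≠ u j) :
    (weightNumRev q z Z u).eval t = -(varWeight q z Z t⁻¹ u * (t * (symDen u).eval t)) := by
  rw [eval_weightNumRev ht hu, eval_symDen_eq_neg ht hu, eval_weightNum_eq_varWeight_mul
    (inv_ne_zero ht) (by rwa [inv_pow, ne_eq, inv_eq_one])
    (fun j ↦ by rw [ne_eq, inv_mul_eq_one₀ ht]; exact htu j)]
  field_simp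
  ring

theorem eval_pairNum_eq_varWeight_add_mul (ht : t ≠ 0) (ht2 : t ^ 2 ≠ 1) (hu : ∀ j, u j ≠ 0)
    (htu : ∀ j, t * u j ≠ 1) (htu' : ∀ j, t ≠ u j) :
    (pairNum q z Z u).eval t =
      (varWeight q z Z t u + varWeight q z Z t⁻¹ u) * (t * (symDen u).eval t) := by
  rw [pairNum, eval_sub, eval_weightNum_eq_varWeight_mul ht ht2 htu,
    eval_weightNumRev_eq_varWeight_inv_mul ht ht2 hu htu']
  ring

theorem eval_zero_pairNum (q z Z : K) (u : Fin n → K) :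
    (pairNum q z Z u).eval 0 = -(Z + z * q ^ (n + 1)) := by
  simp [pairNum, weightNum, weightNumRev, eval_prod]
  ring

theorem natDegree_prod_fin_le {d : ℕ} {f : Fin n → K[X]} (hf : ∀ j, (f j).natDegree ≤ d) :
    (∏ j, f j).natDegree ≤ n * d := by
  simpa using (natDegree_prod_le univ f).trans (sum_le_card_nsmul _ _ d fun j _ ↦ hf j)

theorem natDegree_pairNum_le (q z Z : K) (u : Fin n → K) :
    (pairNum q z Z u).natDegree ≤ 2 * n + 4 := by
  have h₁ : ∀ a b c d : K, ((C a - C b * X) * (C c - C d * X)).natDegree ≤ 2 := fun a b c d ↦ by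
    compute_degree
  refine (natDegree_sub_le_of_le (m := 4 + n * 2) (n := 4 + n * 2) ?_ ?_).trans (by simp; omega)
  · exact natDegree_mul_le_of_le (by compute_degree)
      (natDegree_prod_fin_le fun j ↦ by simpa using h₁ 1 (q * u j) 1 (u j)⁻¹)
  · exact natDegree_mul_le_of_le (by compute_degree)
      (natDegree_prod_fin_le fun j ↦ by simpa using h₁ q (u j)⁻¹ 1 (u j))

end PairNumerator

section PoleCancellation

open Polynomial

variable {K : Type*} [Field K] {q z Z : K} {n : ℕ}

theorem weightNum_eq_mul_removeNth (q z Z : K) (u : Fin (n + 1) → K) (k : Fin (n + 1)) :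
    weightNum q z Z u = (1 - C (q * u k) * X) * (1 - C (u k)⁻¹ * X) *
      weightNum q z Z (k.removeNth u) := by
  rw [weightNum, Fin.prod_univ_succAbove _ k, mul_left_comm]
  rfl

theorem weightNumRev_eq_mul_removeNth (q z Z : K) (u : Fin (n + 1) → K) (k : Fin (n + 1)) :
    weightNumRev q z Z u = (C q - C (u k)⁻¹ * X) * (1 - C (u k) * X) *
      weightNumRev q z Z (k.removeNth u) := by
  rw [weightNumRev, Fin.prod_univ_succAbove _ k, mul_left_comm]
  rfl

theorem signTerm_mul_eval_pairNum_add_update {u : Fin (n + 1) → K} (hu : SignRegular u)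
    (k : Fin (n + 1)) :
    signTerm q z Z u * (pairNum q z Z u).eval (u k) +
      signTerm q z Z (Function.update u k (u k)⁻¹) *
        (pairNum q z Z (Function.update u k (u k)⁻¹)).eval (u k) = 0 := by
  have hk := hu.ne_zero k
  have hmul : ∀ j, u k * k.removeNth u j ≠ 1 := fun j ↦ hu.mul_ne_one (k.succAbove_ne j).symm
  have hne_zero : ∀ j, k.removeNth u j ≠ 0 := fun j ↦ hu.ne_zero (k.succAbove j)
  have hne : ∀ j, u k ≠ k.removeNth u j := fun j ↦ hu.injective.ne (k.succAbove_ne j).symm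
  have hnum := eval_weightNum_eq_varWeight_mul (q := q) (z := z) (Z := Z) hk (hu.sq_ne_one k) hmul
  have hrev := eval_weightNumRev_eq_varWeight_inv_mul (q := q) (z := z) (Z := Z) hk
    (hu.sq_ne_one k) hne_zero hne
  simp only [pairNum, signTerm_eq_varWeight_mul _ _ _ _ k, weightNum_eq_mul_removeNth _ _ _ _ k,
    weightNumRev_eq_mul_removeNth _ _ _ _ k, Fin.removeNth_update, Function.update_self, eval_sub,
    eval_mul, eval_one, eval_C, eval_X, hnum, hrev]
  field_simp
  ring

theorem sum_signTerm_mul_eval_pairNum_eq_zero {x : Fin n → K} (hx : SignRegular x) (k : Fin n) :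
    ∑ σ, signTerm q z Z (signPow x σ) * (pairNum q z Z (signPow x σ)).eval (x k) = 0 := by
  cases n with
  | zero => exact k.elim0
  | succ n =>
    let f σ := signTerm q z Z (signPow x σ) * (pairNum q z Z (signPow x σ)).eval (x k)
    let flip (σ : Fin (n + 1) → ℤˣ) := Function.update σ k (-σ k)
    have hflip : ∀ σ, flip (flip σ) = σ := fun σ ↦ by simp [flip]
    have hadd : ∀ σ, signPow x σ k = x k → f σ + f (flip σ) = 0 := fun σ h ↦ by
      have := signTerm_mul_eval_pairNum_add_update (q := q) (z := z) (Z := Z) (hx.signPow σ) k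
      rwa [← signPow_update_neg, h] at this
    refine sum_involution (f := f) (fun σ _ ↦ flip σ) (fun σ _ ↦ ?_) (fun σ _ _ h ↦ ?_)
      (fun σ _ ↦ mem_univ _) (fun σ _ ↦ hflip σ)
    · rcases signPow_eq_or x σ k with h | h
      · exact hadd σ h
      · have h' : signPow x (flip σ) k = x k := by
          rw [signPow_update_neg, Function.update_self, h, inv_inv]
        rw [add_comm, ← hadd (flip σ) h', hflip]
    · have := congrFun h k
      simp [flip] at this

end PoleCancellation

section Interpolation

open Polynomial

variable {K : Type*} [Field K]

theorem SignRegular.injective_sumElim {ι : Type*} {y : ι → K} (h2 : (2 : K) ≠ 0)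
    (hy : SignRegular y) :
    Function.Injective (Sum.elim ![0, 1, -1] (Sum.elim y fun i ↦ (y i)⁻¹)) := by
  have hneg : (1 : K) ≠ -1 := fun h ↦ h2 (by linear_combination h)
  have hcore : Function.Injective ![(0 : K), 1, -1] := fun i j hij ↦ by
    fin_cases i <;> fin_cases j <;> simp [hneg, hneg.symm] at hij ⊢
  have hcore_ne : ∀ i t, t ≠ 0 → t ^ 2 ≠ 1 → ![(0 : K), 1, -1] i ≠ t := by
    rintro i t h0 h1 rfl
    fin_cases i <;> simp at h0 h1
  refine hcore.sumElim (hy.injective.sumElim (inv_injective.comp hy.injective) fun i j h ↦ ?_)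
    fun i j ↦ ?_
  · have hmul : y i * y j = 1 := by rw [h, inv_mul_cancel₀ (hy.ne_zero j)]
    obtain rfl | hij := eq_or_ne i j
    · exact hy.sq_ne_one i (by rw [sq, hmul])
    · exact hy.mul_ne_one hij hmul
  · rcases j with j | j
    · exact hcore_ne i _ (hy.ne_zero j) (hy.sq_ne_one j)
    · exact hcore_ne i _ (inv_ne_zero (hy.ne_zero j)) (by simpa using hy.sq_ne_one j)

theorem eq_zero_of_antisymm_of_eval_eq_zero {m : ℕ} {P : K[X]} {y : Fin m → K}
    (h2 : (2 : K) ≠ 0) (hy : SignRegular y) (hdeg : P.natDegree ≤ 2 * m + 2)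
    (hanti : ∀ t ≠ 0, P.eval t = -(t ^ (2 * m + 2) * P.eval t⁻¹)) (h0 : P.eval 0 = 0)
    (hroot : ∀ i, P.eval (y i) = 0) : P = 0 := by
  have hself : ∀ t : K, t ^ 2 = 1 → P.eval t = 0 := fun t ht ↦ by
    have ht' : t⁻¹ = t := inv_eq_of_mul_eq_one_right (by rw [← sq, ht])
    have h := hanti t (by rintro rfl; simp at ht)
    rw [ht', show 2 * m + 2 = 2 * (m + 1) by ring, pow_mul, ht, one_pow, one_mul] at h
    exact (mul_eq_zero_iff_left h2).1 (by linear_combination h)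
  refine eq_zero_of_natDegree_lt_card_of_eval_eq_zero P (hy.injective_sumElim h2) ?_
    (by simp; omega)
  rintro (i | i | i)
  · fin_cases i
    · exact h0
    · exact hself 1 (one_pow 2)
    · exact hself (-1) neg_one_sq
  · exact hroot i
  · change P.eval (y i)⁻¹ = 0
    rw [hanti _ (inv_ne_zero (hy.ne_zero i)), inv_inv, hroot, mul_zero, neg_zero]

end Interpolation

section PoisedSum

variable {K : Type*} [Field K] {q z : K} {n : ℕ}

/-- The coefficients of the expansion of `clearedSum` in the products `nodeProd (z q^m)`. -/
noncomputable def poisedCoeff (q z : K) (n r m : ℕ) : K :=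
  (∏ i ∈ range n, (q ^ r + q ^ (i + 1))) * poisedWeight (z ^ 2) q r m / (q ^ m) ^ n

/-- The product `∏ i, (1 - w x_i) (1 - w / x_i)`, an element of the basis in which `clearedSum` is
expanded. -/
def nodeProd (w : K) (x : Fin n → K) : K :=
  ∏ i, ((1 - w * x i) * (1 - w / x i))

/-- The right-hand side of the theorem multiplied by `nodeProd z x`. -/
noncomputable def poisedSum (q z : K) (r : ℕ) (x : Fin n → K) : K :=
  ∑ m ∈ range (r + 1), poisedCoeff q z n r m * nodeProd (z * q ^ m) x

theorem pow_mul_poisedCoeff_succ_left (hq : q ≠ 0) (z : K) (n r m : ℕ) :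
    q ^ m * poisedCoeff q z (n + 1) r m = (q ^ r + q ^ (n + 1)) * poisedCoeff q z n r m := by
  rw [poisedCoeff, poisedCoeff, prod_range_succ]
  field_simp
  ring

theorem prod_range_succ_pow_succ_add_pow (q : K) (n r : ℕ) :
    ∏ i ∈ range (n + 1), (q ^ (r + 1) + q ^ (i + 1)) =
      q ^ (n + 1) * (1 + q ^ r) * ∏ i ∈ range n, (q ^ r + q ^ (i + 1)) := by
  have hmul : ∀ i, q ^ (r + 1) + q ^ (i + 1) = q * (q ^ r + q ^ i) := fun i ↦ by ring
  simp only [hmul, prod_mul_distrib, prod_const, card_range, prod_range_succ', pow_zero]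
  ring

theorem poisedCoeff_succ_succ {r m : ℕ} (hq : q ≠ 0) (hneg : 1 + q ^ r ≠ 0)
    (hroot : q ^ (m + 1) ≠ 1) (hz : z ^ 2 * q ^ (m + 1) ≠ 1) :
    poisedCoeff q z (n + 1) (r + 1) (m + 1) * ((1 - z ^ 2 * q ^ (m + 1)) * (1 - q ^ (m + 1))) =
      (1 - q * z ^ 2) * (1 - q ^ (r + 1)) * poisedCoeff q (q * z) n r m := by
  have hweight := poisedWeight_succ_succ hneg hroot hz
  rw [poisedCoeff, poisedCoeff, prod_range_succ_pow_succ_add_pow, mul_pow q z]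
  rw [div_mul_eq_mul_div, ← mul_div_assoc, div_eq_div_iff (pow_ne_zero _ (pow_ne_zero _ hq))
    (pow_ne_zero _ (pow_ne_zero _ hq))]
  linear_combination
    q ^ (n + 1) * (q ^ m) ^ n * (∏ i ∈ range n, (q ^ r + q ^ (i + 1))) * hweight

theorem nodeProd_vecCons (w t : K) (x : Fin n → K) :
    nodeProd w (vecCons t x) = (1 - w * t) * (1 - w / t) * nodeProd w x :=
  Fin.prod_univ_succ _

theorem poisedSum_zero_vecCons_self (hz : z ≠ 0) (x : Fin n → K) :
    poisedSum q z 0 (vecCons z x) = 0 := by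
  simp [poisedSum, nodeProd_vecCons, hz]

theorem poisedSum_succ_vecCons_self (hq : q ≠ 0) (hneg : ∀ k : ℕ, 1 + q ^ k ≠ 0)
    (hroot : ∀ k : ℕ, q ^ (k + 1) ≠ 1) (hz : z ≠ 0) (hz2 : ∀ k : ℕ, z ^ 2 * q ^ k ≠ 1)
    (r : ℕ) (x : Fin n → K) :
    poisedSum q z (r + 1) (vecCons z x) =
      (1 - q * z ^ 2) * (1 - q ^ (r + 1)) * poisedSum q (q * z) r x := by
  have hfirst : nodeProd (z * q ^ 0) (vecCons z x) = 0 := by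
    simp [nodeProd_vecCons, hz]
  rw [poisedSum, poisedSum, sum_range_succ', hfirst, mul_zero, add_zero, mul_sum]
  refine sum_congr rfl fun m _ ↦ ?_
  rw [← mul_assoc, ← poisedCoeff_succ_succ hq (hneg r) (hroot m) (hz2 _), nodeProd_vecCons,
    mul_div_cancel_left₀ _ hz, show q * z * q ^ m = z * q ^ (m + 1) by ring]
  ring

theorem prod_div_mul_signTerm {u : Fin n → K} (hu : ∀ j, z * u j ≠ 1) (Z : K) :
    (∏ j, (1 - q * z * u j) / (1 - z * u j)) * signTerm q z Z u = signTerm q (q * z) Z u := by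
  rw [signTerm, signTerm, ← mul_assoc, ← prod_mul_distrib]
  congr 1
  refine prod_congr rfl fun j _ ↦ ?_
  have : 1 - z * u j ≠ 0 := sub_ne_zero.2 (hu j).symm
  field_simp

theorem SignRegular.tail {t : K} {x : Fin n → K} (h : SignRegular (vecCons t x)) :
    SignRegular x :=
  h.comp (Fin.succ_injective n)

theorem SignRegular.vecCons_signPow {t : K} {x : Fin n → K} (h : SignRegular (vecCons t x))
    (σ : Fin n → ℤˣ) : SignRegular (vecCons t (_root_.signPow x σ)) := by
  simpa only [signPow_vecCons, Units.val_one, zpow_one] using h.signPow (vecCons 1 σ)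

theorem clearedSum_vecCons_self {x : Fin n → K} (h : SignRegular (vecCons z x)) (Z : K) :
    clearedSum q z Z (vecCons z x) =
      (1 - q * z ^ 2) * (1 - Z / z) * clearedSum q (q * z) Z x := by
  have hz : z ≠ 0 := h.ne_zero 0
  have hz2 : 1 - z ^ 2 ≠ 0 := sub_ne_zero.2 (h.sq_ne_one 0).symm
  rw [clearedSum_vecCons, clearedSum, mul_sum]
  refine sum_congr rfl fun τ _ ↦ ?_
  have hτ : ∀ j, z * signPow x τ j ≠ 1 := fun j ↦
    (h.vecCons_signPow τ).mul_ne_one (Fin.succ_ne_zero j).symm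
  have hinv : varWeight q z Z z⁻¹ (signPow x τ) = 0 := by simp [varWeight, hz]
  rw [hinv, add_zero, varWeight, mul_assoc, prod_div_mul_signTerm hτ]
  field_simp

end PoisedSum

section Expansion

open Polynomial

variable {K : Type*} [Field K] {q z Z t : K} {n : ℕ} {x : Fin n → K}

/-- The numerator of `clearedSum q z Z (vecCons t x)` over the denominator `t * symDen x`, as a
polynomial in `t`. -/
noncomputable def clearedNum (q z Z : K) (x : Fin n → K) : K[X] :=
  ∑ τ, C (signTerm q z Z (signPow x τ)) * pairNum q z Z (signPow x τ)

/-- The polynomial in `t` which represents `t * poisedSum q z r (vecCons t x)`. -/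
noncomputable def poisedPoly (q z : K) (r : ℕ) (x : Fin n → K) : K[X] :=
  ∑ m ∈ range (r + 1), C (poisedCoeff q z (n + 1) r m * nodeProd (z * q ^ m) x) *
    ((1 - C (z * q ^ m) * X) * (X - C (z * q ^ m)))

theorem natDegree_clearedNum_le (q z Z : K) (x : Fin n → K) :
    (clearedNum q z Z x).natDegree ≤ 2 * n + 4 :=
  natDegree_sum_le_of_forall_le _ _ fun _ _ ↦
    (natDegree_C_mul_le _ _).trans (natDegree_pairNum_le _ _ _ _)

theorem natDegree_poisedPoly_le (q z : K) (r : ℕ) (x : Fin n → K) :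
    (poisedPoly q z r x).natDegree ≤ 2 :=
  natDegree_sum_le_of_forall_le _ _ fun _ _ ↦
    (natDegree_C_mul_le _ _).trans (by compute_degree)

theorem natDegree_symDen_le (x : Fin n → K) : (symDen x).natDegree ≤ 2 * n + 2 := by
  refine (natDegree_mul_le_of_le (m := 2) (by compute_degree)
    (natDegree_prod_fin_le (d := 2) fun j ↦ ?_)).trans (by omega)
  compute_degree

theorem eval_clearedNum_eq_neg (ht : t ≠ 0) (hx : ∀ i, x i ≠ 0) :
    (clearedNum q z Z x).eval t = -(t ^ (2 * n + 4) * (clearedNum q z Z x).eval t⁻¹) := by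
  simp only [clearedNum, eval_finsetSum, eval_mul, eval_C, mul_sum, ← sum_neg_distrib]
  refine sum_congr rfl fun τ _ ↦ ?_
  rw [eval_pairNum_eq_neg (u := signPow x τ) ht fun j ↦ zpow_ne_zero _ (hx j)]
  ring

theorem eval_poisedPoly (ht : t ≠ 0) (r : ℕ) :
    (poisedPoly q z r x).eval t = t * poisedSum q z r (vecCons t x) := by
  simp only [poisedPoly, poisedSum, nodeProd_vecCons, eval_finsetSum, eval_mul, eval_sub, eval_one,
    eval_C, eval_X, mul_sum]
  refine sum_congr rfl fun m _ ↦ ?_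
  field_simp

theorem poisedSum_vecCons_inv (q z t : K) (r : ℕ) (x : Fin n → K) :
    poisedSum q z r (vecCons t⁻¹ x) = poisedSum q z r (vecCons t x) := by
  simp only [poisedSum, nodeProd_vecCons, div_inv_eq_mul, ← div_eq_mul_inv]
  exact sum_congr rfl fun m _ ↦ by ring

theorem eval_clearedNum (h : SignRegular (vecCons t x)) :
    (clearedNum q z Z x).eval t =
      t * (symDen x).eval t * clearedSum q z Z (vecCons t x) := by
  rw [clearedSum_vecCons, clearedNum, eval_finsetSum, mul_sum]
  refine sum_congr rfl fun τ _ ↦ ?_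
  have hτ := h.vecCons_signPow τ
  rw [eval_mul, eval_C, eval_pairNum_eq_varWeight_add_mul (t := t) (u := signPow x τ)
    (hτ.ne_zero 0) (hτ.sq_ne_one 0) (fun j ↦ hτ.ne_zero j.succ)
    (fun j ↦ hτ.mul_ne_one (Fin.succ_ne_zero j).symm)
    (fun j ↦ hτ.injective.ne (Fin.succ_ne_zero j).symm), symDen_signPow]
  ring

theorem eval_symDen_self (hx : ∀ i, x i ≠ 0) (i : Fin n) : (symDen x).eval (x i) = 0 := by
  simp only [symDen, eval_mul, eval_prod]
  rw [prod_eq_zero (mem_univ i) (by simp [hx i]), mul_zero]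

theorem eval_symDen_ne_zero (h : SignRegular (vecCons t x)) : (symDen x).eval t ≠ 0 := by
  simp only [symDen, eval_mul, eval_prod, eval_sub, eval_one, eval_pow, eval_X, eval_C]
  refine mul_ne_zero (sub_ne_zero.2 (h.sq_ne_one 0).symm) (prod_ne_zero_iff.2 fun j _ ↦
    mul_ne_zero (sub_ne_zero.2 (h.mul_ne_one (Fin.succ_ne_zero j)).symm) (sub_ne_zero.2 ?_))
  have hj : x j ≠ 0 := h.ne_zero j.succ
  rw [ne_comm, ne_eq, inv_mul_eq_one₀ hj]
  exact h.injective.ne (Fin.succ_ne_zero j)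

theorem eval_zero_clearedNum (q z Z : K) (x : Fin n → K) :
    (clearedNum q z Z x).eval 0 = -(Z + z * q ^ (n + 1)) * clearedSum q z Z x := by
  simp only [clearedNum, clearedSum, eval_finsetSum, eval_mul, eval_C, eval_zero_pairNum, mul_sum,
    mul_comm]

theorem eval_zero_symDen (x : Fin n → K) : (symDen x).eval 0 = 1 := by
  simp [symDen, eval_prod]

theorem eval_zero_poisedPoly (hq : q ≠ 0) (z : K) (r : ℕ) (x : Fin n → K) :
    (poisedPoly q z r x).eval 0 = -(z * (q ^ r + q ^ (n + 1))) * poisedSum q z r x := by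
  simp only [poisedPoly, poisedSum, eval_finsetSum, mul_sum]
  refine sum_congr rfl fun m _ ↦ ?_
  simp only [eval_mul, eval_sub, eval_one, eval_C, eval_X]
  linear_combination -z * nodeProd (z * q ^ m) x * pow_mul_poisedCoeff_succ_left hq z n r m

theorem clearedSum_vecCons_eq_poisedSum (hq : q ≠ 0) (h2 : (2 : K) ≠ 0) {r : ℕ}
    (hz : SignRegular (vecCons z x)) (ht : SignRegular (vecCons t x))
    (hzero : clearedSum q z (q ^ r * z) x = poisedSum q z r x)
    (hself : clearedSum q z (q ^ r * z) (vecCons z x) = poisedSum q z r (vecCons z x)) :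
    clearedSum q z (q ^ r * z) (vecCons t x) = poisedSum q z r (vecCons t x) := by
  have hx : ∀ i, x i ≠ 0 := hz.tail.ne_zero
  have heval : ∀ {s}, SignRegular (vecCons s x) →
      (clearedNum q z (q ^ r * z) x - symDen x * poisedPoly q z r x).eval s =
        s * (symDen x).eval s *
          (clearedSum q z (q ^ r * z) (vecCons s x) - poisedSum q z r (vecCons s x)) := by
    intro s hs
    have hs0 : s ≠ 0 := hs.ne_zero 0
    rw [eval_sub, eval_mul, eval_clearedNum hs, eval_poisedPoly hs0]
    ring
  have hP : clearedNum q z (q ^ r * z) x - symDen x * poisedPoly q z r x = 0 := by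
    refine eq_zero_of_antisymm_of_eval_eq_zero (m := n + 1) h2 hz ?_ (fun s hs ↦ ?_) ?_
      (Fin.cases ?_ fun i ↦ ?_)
    · exact natDegree_sub_le_of_le (natDegree_clearedNum_le _ _ _ _)
        (natDegree_mul_le_of_le (natDegree_symDen_le x) (natDegree_poisedPoly_le _ _ _ _))
        |>.trans (by simp; omega)
    · rw [eval_sub, eval_sub, eval_mul, eval_mul, eval_clearedNum_eq_neg hs hx,
        eval_symDen_eq_neg hs hx, eval_poisedPoly hs, eval_poisedPoly (inv_ne_zero hs),
        poisedSum_vecCons_inv]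
      field_simp
      ring
    · rw [eval_sub, eval_mul, eval_zero_clearedNum, eval_zero_symDen, eval_zero_poisedPoly hq,
        hzero]
      ring
    · exact (heval hz).trans (by rw [hself, sub_self, mul_zero])
    · change eval (x i) _ = 0
      rw [eval_sub, eval_mul, eval_symDen_self hx, zero_mul, sub_zero, clearedNum, eval_finsetSum]
      simp only [eval_mul, eval_C]
      exact sum_signTerm_mul_eval_pairNum_eq_zero hz.tail i
  have ht0 : t ≠ 0 := ht.ne_zero 0
  have h := heval ht
  rw [hP, eval_zero, eq_comm, mul_eq_zero_iff_left (mul_ne_zero ht0 (eval_symDen_ne_zero ht))] at h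
  exact sub_eq_zero.1 h

/-- The conditions on `q`, `z` and `x` under which the expansion is proved by induction: they
exclude the poles of both sides and are inherited by `(q, q z, x)`. -/
structure IsGeneric (q z : K) (x : Fin n → K) : Prop where
  q_ne_zero : q ≠ 0
  one_add_pow_ne_zero : ∀ k : ℕ, 1 + q ^ k ≠ 0
  pow_ne_one : ∀ k : ℕ, q ^ (k + 1) ≠ 1
  sq_mul_pow_ne_one : ∀ k : ℕ, z ^ 2 * q ^ k ≠ 1
  signRegular : ∀ k : ℕ, SignRegular (vecCons (z * q ^ k) x)

theorem IsGeneric.two_ne_zero (h : IsGeneric q z x) : (2 : K) ≠ 0 := by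
  simpa [one_add_one_eq_two] using h.one_add_pow_ne_zero 0

theorem IsGeneric.signRegular_self (h : IsGeneric q z x) : SignRegular (vecCons z x) := by
  simpa using h.signRegular 0

theorem IsGeneric.mul_left (h : IsGeneric q z x) : IsGeneric q (q * z) x where
  q_ne_zero := h.q_ne_zero
  one_add_pow_ne_zero := h.one_add_pow_ne_zero
  pow_ne_one := h.pow_ne_one
  sq_mul_pow_ne_one k := by
    convert h.sq_mul_pow_ne_one (k + 2) using 1
    ring
  signRegular k := by
    convert h.signRegular (k + 1) using 2
    ring

theorem IsGeneric.tail {x : Fin (n + 1) → K} (h : IsGeneric q z x) :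
    IsGeneric q z (vecTail x) where
  q_ne_zero := h.q_ne_zero
  one_add_pow_ne_zero := h.one_add_pow_ne_zero
  pow_ne_one := h.pow_ne_one
  sq_mul_pow_ne_one := h.sq_mul_pow_ne_one
  signRegular k := by
    convert (h.signRegular k).comp (Fin.succAbove_right_injective (p := 1)) using 1
    ext i
    cases i using Fin.cases <;> rfl

theorem clearedSum_eq_poisedSum (h : IsGeneric q z x) (r : ℕ) :
    clearedSum q z (q ^ r * z) x = poisedSum q z r x := by
  induction n generalizing z r with
  | zero =>
    simpa [clearedSum, poisedSum, signTerm, nodeProd, poisedCoeff] using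
      (sum_range_poisedWeight h.one_add_pow_ne_zero h.pow_ne_one h.sq_mul_pow_ne_one r).symm
  | succ n ih =>
    have hx : vecCons (vecHead x) (vecTail x) = x := Matrix.cons_head_tail x
    have hz : z ≠ 0 := h.signRegular_self.ne_zero 0
    have hreg : SignRegular (vecCons (vecHead x) (vecTail x)) := hx.symm ▸ h.signRegular_self.tail
    rw [← hx]
    refine clearedSum_vecCons_eq_poisedSum h.q_ne_zero h.two_ne_zero h.tail.signRegular_self hreg
      (ih h.tail r) ?_
    rw [clearedSum_vecCons_self h.tail.signRegular_self, mul_div_cancel_right₀ _ hz]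
    cases r with
    | zero => rw [poisedSum_zero_vecCons_self hz, pow_zero, sub_self, mul_zero, zero_mul]
    | succ r =>
      rw [poisedSum_succ_vecCons_self h.q_ne_zero h.one_add_pow_ne_zero h.pow_ne_one hz
        h.sq_mul_pow_ne_one, ← ih h.tail.mul_left, ← mul_assoc (q ^ r), ← pow_succ]

end Expansion

section Parameters

variable {K : Type*} [Field K] {n : ℕ}

theorem forall_lowerParams {p : Fin (n + n + 1 + 2) → Prop} (h0 : p 0) (h1 : p 1)
    (h2 : p 2) (hl : ∀ i : Fin n, p (Fin.castAdd n i).succ.succ.succ)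
    (hr : ∀ i : Fin n, p (Fin.natAdd n i).succ.succ.succ) (i) : p i := by
  refine Fin.cases h0 (fun i ↦ Fin.cases h1 (fun i ↦ Fin.cases h2 (fun i ↦ ?_) i) i) i
  exact Fin.addCases (motive := fun i ↦ p i.succ.succ.succ) hl hr i

theorem isVeryWellPoised_params (r : ℕ) {x : Fin n → K} {z q : K} (hq : q ≠ 0)
    (hx : ∀ i, x i ≠ 0) : IsVeryWellPoised (upperParams r x z q) (lowerParams r x z q) q := by
  refine ⟨forall_lowerParams ?_ ?_ ?_ (fun i ↦ ?_) (fun i ↦ ?_), z, rfl, rfl, rfl⟩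
  · change q * z * z = q * z ^ 2
    ring
  · change -(q * z) * -z = q * z ^ 2
    ring
  · change q ^ (-(r : ℤ)) * (q ^ (r + 1) * z ^ 2) = q * z ^ 2
    rw [zpow_neg, zpow_natCast, pow_succ]
    field_simp
  · have := hx i
    simp only [upperParams, lowerParams, Matrix.cons_val_succ, Matrix.cons_val_zero,
      Fin.append_left]
    field_simp
  · have := hx i
    simp only [upperParams, lowerParams, Matrix.cons_val_succ, Matrix.cons_val_zero,
      Fin.append_right]
    field_simp

theorem prod_upperParams (r : ℕ) (x : Fin n → K) (z q : K) (f : K → K) :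
    ∏ i, f (upperParams r x z q i) =
      f (z ^ 2) * (f (q * z) * (f (-(q * z)) * (f (q ^ (-(r : ℤ))) *
        ((∏ i, f (q * z * x i)) * ∏ i, f (q * z / x i))))) := by
  simp only [Fin.prod_univ_succ, Fin.prod_univ_add, upperParams, Matrix.cons_val_succ,
    Matrix.cons_val_zero, Fin.append_left, Fin.append_right]

theorem prod_lowerParams (r : ℕ) (x : Fin n → K) (z q : K) (f : K → K) :
    ∏ i, f (lowerParams r x z q i) =
      f z * (f (-z) * (f (q ^ (r + 1) * z ^ 2) *
        ((∏ i, f (z / x i)) * ∏ i, f (z * x i)))) := by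
  simp only [Fin.prod_univ_succ, Fin.prod_univ_add, lowerParams, Matrix.cons_val_succ,
    Matrix.cons_val_zero, Fin.append_left, Fin.append_right]

theorem qHypTerm_params_eq_zero {r m : ℕ} (x : Fin n → K) (z : K) {q : K} (w : K) (hq : q ≠ 0)
    (h : r < m) : qHypTerm (upperParams r x z q) (lowerParams r x z q) q w m = 0 := by
  rw [qHypTerm, prod_upperParams _ _ _ _ (qPoch · q m), qPoch_zpow_neg_eq_zero hq h]
  simp

end Parameters

section GenericIdentity

variable {K : Type*} [Field K] {q z : K} {n : ℕ} {x : Fin n → K}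

/-- The factor in front of the series in the theorem. -/
noncomputable def prefactor (q z : K) (n r : ℕ) : K :=
  q ^ ((n : ℤ) * (r : ℤ) - (r.choose 2 : ℤ)) * qPochInt (-q) q ((n : ℤ) - (r : ℤ)) *
    (qPoch (q * z ^ 2) (q ^ 2) r / qPoch (q * z ^ 2) q r)

theorem qPochInt_neg_add_one (hq : q ≠ 0) (hneg : ∀ d : ℤ, 1 + q ^ d ≠ 0) (d : ℤ) :
    qPochInt (-q) q (d + 1) = qPochInt (-q) q d * (1 + q ^ (d + 1)) := by
  have h : ∀ d : ℤ, 1 - -q * q ^ d = 1 + q ^ (d + 1) := fun d ↦ by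
    rw [zpow_add_one₀ hq]
    ring
  rw [qPochInt_add_one hq fun d ↦ (sub_ne_zero.1 (h d ▸ hneg (d + 1))).symm, h]

theorem zpow_mul_qPochInt_neg_mul_qPoch_neg_one (hq : q ≠ 0) (hneg : ∀ d : ℤ, 1 + q ^ d ≠ 0)
    (r : ℕ) : q ^ (-(r.choose 2 : ℤ)) * qPochInt (-q) q (-(r : ℤ)) * qPoch (-1) q r = 1 := by
  induction r with
  | zero => simp [qPochInt, qPoch_zero]
  | succ r ih =>
    have hr : q ^ r ≠ 0 := pow_ne_zero r hq
    have hstep := qPochInt_neg_add_one hq hneg (-(r + 1))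
    rw [show -((r : ℤ) + 1) + 1 = -r by ring, zpow_neg q r, zpow_natCast] at hstep
    rw [hstep] at ih
    rw [Nat.choose_succ_succ' r 1, Nat.choose_one_right, qPoch_succ]
    push_cast
    rw [neg_add, zpow_add₀ hq, zpow_neg q r, zpow_natCast]
    linear_combination ih + q ^ (-(r.choose 2 : ℤ)) * qPochInt (-q) q (-(r + 1)) *
      qPoch (-1) q r * inv_mul_cancel₀ hr

theorem zpow_mul_qPochInt_mul_qPoch_neg_one (hq : q ≠ 0) (hneg : ∀ d : ℤ, 1 + q ^ d ≠ 0)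
    (n r : ℕ) :
    q ^ ((n : ℤ) * (r : ℤ) - (r.choose 2 : ℤ)) * qPochInt (-q) q ((n : ℤ) - (r : ℤ)) *
      qPoch (-1) q r = ∏ i ∈ range n, (q ^ r + q ^ (i + 1)) := by
  induction n with
  | zero => simpa using zpow_mul_qPochInt_neg_mul_qPoch_neg_one hq hneg r
  | succ n ih =>
    have hfactor : q ^ r * (1 + q ^ ((n : ℤ) - r + 1)) = q ^ r + q ^ (n + 1) := by
      rw [mul_add, mul_one, ← zpow_natCast q r, ← zpow_add₀ hq, ← zpow_natCast q (n + 1)]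
      congr 2
      push_cast
      ring
    rw [prod_range_succ, ← ih, ← hfactor]
    push_cast
    rw [show (n : ℤ) + 1 - r = n - r + 1 by ring, qPochInt_neg_add_one hq hneg, add_one_mul,
      add_sub_right_comm, zpow_add₀ hq, zpow_natCast]
    ring

theorem qPoch_mul_qPoch_mul_pow (a q : K) (r m : ℕ) :
    qPoch a q m * qPoch (a * q ^ m) q (r + 1) =
      (1 - a) * qPoch (q * a) q r * qPoch (a * q ^ (r + 1)) q m := by
  rw [← qPoch_add, add_comm, qPoch_add, qPoch_succ']

theorem IsGeneric.mul_pow_ne_one (h : IsGeneric q z x) (k : ℕ) : z * q ^ k ≠ 1 := fun e ↦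
  h.sq_mul_pow_ne_one (2 * k) (by rw [pow_mul', ← mul_pow, e, one_pow])

theorem IsGeneric.neg_mul_pow_ne_one (h : IsGeneric q z x) (k : ℕ) : -z * q ^ k ≠ 1 := fun e ↦
  h.sq_mul_pow_ne_one (2 * k) (by rw [pow_mul', ← neg_sq, ← mul_pow, e, one_pow])

theorem IsGeneric.one_add_zpow_ne_zero (h : IsGeneric q z x) (d : ℤ) : 1 + q ^ d ≠ 0 := by
  obtain ⟨k, rfl | rfl⟩ := d.eq_nat_or_neg
  · simpa using h.one_add_pow_ne_zero k
  · have hk : 1 + q ^ (-(k : ℤ)) = (1 + q ^ k) / q ^ k := by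
      have := h.q_ne_zero
      rw [zpow_neg, zpow_natCast]
      field_simp
      ring
    rw [hk]
    exact div_ne_zero (h.one_add_pow_ne_zero k) (pow_ne_zero k h.q_ne_zero)

theorem IsGeneric.mul_mul_pow_ne_one (h : IsGeneric q z x) (i : Fin n) (k : ℕ) :
    z * x i * q ^ k ≠ 1 := by
  rw [mul_right_comm]
  exact (h.signRegular k).mul_ne_one (Fin.succ_ne_zero i).symm

theorem IsGeneric.div_mul_pow_ne_one (h : IsGeneric q z x) (i : Fin n) (k : ℕ) :
    z / x i * q ^ k ≠ 1 := by
  have hi : x i ≠ 0 := h.signRegular_self.ne_zero i.succ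
  rw [div_mul_eq_mul_div, ne_eq, div_eq_one_iff_eq hi]
  exact (h.signRegular k).injective.ne (Fin.succ_ne_zero i).symm

theorem IsGeneric.nodeProd_ne_zero (h : IsGeneric q z x) : nodeProd z x ≠ 0 :=
  prod_ne_zero_iff.2 fun i _ ↦ mul_ne_zero
    (sub_ne_zero.2 (by simpa using (h.mul_mul_pow_ne_one i 0).symm))
    (sub_ne_zero.2 (by simpa using (h.div_mul_pow_ne_one i 0).symm))

theorem IsGeneric.qHypTerm_params (h : IsGeneric q z x) (r m : ℕ) (w : K) :
    qHypTerm (upperParams r x z q) (lowerParams r x z q) q w m =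
      qPoch (z ^ 2) q m * qPoch (q ^ (-(r : ℤ))) q m /
        (qPoch (z ^ 2 * q ^ (r + 1)) q m * qPoch q q m) *
      ((1 - z ^ 2 * q ^ (2 * m)) / (1 - z ^ 2)) * (nodeProd (z * q ^ m) x / nodeProd z x) *
      w ^ m := by
  have hsqrt : qPoch (q * z) q m / qPoch z q m * (qPoch (-(q * z)) q m / qPoch (-z) q m) =
      (1 - z ^ 2 * q ^ (2 * m)) / (1 - z ^ 2) := by
    rw [← mul_neg, qPoch_mul_div_qPoch h.mul_pow_ne_one, qPoch_mul_div_qPoch h.neg_mul_pow_ne_one,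
      div_mul_div_comm]
    congr 1 <;> ring
  have hnode : (∏ i, qPoch (q * z * x i) q m) / (∏ i, qPoch (z * x i) q m) *
      ((∏ i, qPoch (q * z / x i) q m) / ∏ i, qPoch (z / x i) q m) =
        nodeProd (z * q ^ m) x / nodeProd z x := by
    simp only [nodeProd, ← prod_div_distrib, ← prod_mul_distrib]
    refine prod_congr rfl fun i _ ↦ ?_
    rw [mul_assoc q, mul_div_assoc q, qPoch_mul_div_qPoch (h.mul_mul_pow_ne_one i),
      qPoch_mul_div_qPoch (h.div_mul_pow_ne_one i), div_mul_div_comm, mul_right_comm z,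
      div_mul_eq_mul_div]
  rw [qHypTerm, prod_upperParams _ _ _ _ (qPoch · q m), prod_lowerParams _ _ _ _ (qPoch · q m),
    ← hsqrt, ← hnode, mul_comm (q ^ (r + 1))]
  simp only [div_eq_mul_inv, mul_inv]
  ring

theorem neg_zpow_sub_pow (hq : q ≠ 0) (n r m : ℕ) :
    (-q ^ ((r : ℤ) - (n : ℤ))) ^ m = (-q ^ r) ^ m / (q ^ m) ^ n := by
  rw [zpow_sub₀ hq, zpow_natCast, zpow_natCast, ← neg_div, div_pow, ← pow_mul, ← pow_mul,
    mul_comm n]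

theorem IsGeneric.prefactor_mul_qHypTerm_mul_nodeProd (h : IsGeneric q z x) (r m : ℕ) :
    prefactor q z n r * qHypTerm (upperParams r x z q) (lowerParams r x z q) q
      (-q ^ ((r : ℤ) - (n : ℤ))) m * nodeProd z x =
        poisedCoeff q z n r m * nodeProd (z * q ^ m) x := by
  have hz2 : ∀ j k : ℕ, z ^ 2 * q ^ j * q ^ k ≠ 1 := fun j k ↦ by
    rw [mul_assoc, ← pow_add]
    exact h.sq_mul_pow_ne_one _
  have h₁ : 1 - z ^ 2 ≠ 0 := sub_ne_zero.2 (h.signRegular_self.sq_ne_one 0).symm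
  have h₂ : qPoch (-1) q r ≠ 0 := qPoch_ne_zero fun i _ e ↦
    h.one_add_pow_ne_zero i (by linear_combination -e)
  have h₃ : qPoch (q * z ^ 2) q r ≠ 0 := qPoch_ne_zero fun i _ ↦ by simpa [mul_comm] using hz2 1 i
  have h₄ : qPoch (z ^ 2 * q ^ (r + 1)) q m ≠ 0 := qPoch_ne_zero fun i _ ↦ hz2 (r + 1) i
  have h₅ : qPoch (z ^ 2 * q ^ m) q (r + 1) ≠ 0 := qPoch_ne_zero fun i _ ↦ hz2 m i
  have h₈ : qPoch q q m ≠ 0 := qPoch_ne_zero fun i _ ↦ by simpa [pow_succ'] using h.pow_ne_one i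
  have h₆ := h.nodeProd_ne_zero
  have h₇ := h.q_ne_zero
  rw [h.qHypTerm_params, neg_zpow_sub_pow h.q_ne_zero, prefactor, poisedCoeff, poisedWeight,
    ← zpow_mul_qPochInt_mul_qPoch_neg_one h.q_ne_zero h.one_add_zpow_ne_zero,
    ← qPoch_zpow_neg_mul_pow h.q_ne_zero]
  have hsplit := qPoch_mul_qPoch_mul_pow (z ^ 2) q r m
  field_simp
  linear_combination qPochInt (-q) q ((n : ℤ) - (r : ℤ)) * qPoch (q * z ^ 2) (q ^ 2) r *
    qPoch (q ^ (-(r : ℤ))) q m * (1 - z ^ 2 * q ^ (2 * m)) * nodeProd (z * q ^ m) x * hsplit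

theorem IsGeneric.nodeProd_mul_signSum (h : IsGeneric q z x) (r : ℕ) :
    nodeProd z x * signSum r x z q = clearedSum q z (q ^ r * z) x := by
  rw [signSum, clearedSum, mul_sum]
  refine sum_congr rfl fun σ _ ↦ ?_
  rw [← mul_assoc, signTerm, nodeProd, ← prod_mul_distrib]
  congr 1
  refine prod_congr rfl fun i _ ↦ ?_
  have hne : 1 - z / signPow x σ i ≠ 0 := by
    rcases signPow_eq_or x σ i with e | e <;> rw [e]
    · exact sub_ne_zero.2 (by simpa using (h.div_mul_pow_ne_one i 0).symm)
    · exact sub_ne_zero.2 (by simpa using (h.mul_mul_pow_ne_one i 0).symm)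
  have hnode : (1 - z * x i) * (1 - z / x i) =
      (1 - z / signPow x σ i) * (1 - z * signPow x σ i) := by
    rcases signPow_eq_or x σ i with e | e <;> rw [e, mul_comm]
    rw [div_inv_eq_mul, div_eq_mul_inv, mul_comm]
  have hsq : x i ^ (2 * (σ i : ℤ)) = signPow x σ i ^ 2 := by
    rw [mul_comm, zpow_mul]
    norm_cast
  rw [hnode, hsq, zpow_neg, ← div_eq_mul_inv, ← div_eq_mul_inv]
  change _ * (_ * ((1 - q ^ r * z / signPow x σ i) / (1 - z / signPow x σ i))) = _
  field_simp

theorem IsGeneric.signSum_eq_sum (h : IsGeneric q z x) (r : ℕ) :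
    signSum r x z q = prefactor q z n r * ∑ m ∈ range (r + 1),
      qHypTerm (upperParams r x z q) (lowerParams r x z q) q (-q ^ ((r : ℤ) - (n : ℤ))) m := by
  apply mul_right_cancel₀ h.nodeProd_ne_zero
  rw [mul_comm, h.nodeProd_mul_signSum, clearedSum_eq_poisedSum h, poisedSum, mul_sum, sum_mul]
  exact sum_congr rfl fun m _ ↦ (h.prefactor_mul_qHypTerm_mul_nodeProd r m).symm

end GenericIdentity

section Specialization

variable {A F K : Type*} [CommRing A] [Field F] [Algebra A F] [Field K]

/-- The pairs `(a / b, φ a / φ b)` with `φ b ≠ 0`. Where `A` embeds in `F` they form the graph of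
the extension of `φ` to the local ring of its kernel. -/
def specializationSubring (F : Type*) [Field F] [Algebra A F] (φ : A →+* K) :
    Subring (F × K) where
  carrier := {p | ∃ a b, φ b ≠ 0 ∧ p.1 * algebraMap A F b = algebraMap A F a ∧ p.2 * φ b = φ a}
  one_mem' := ⟨1, 1, by simp⟩
  zero_mem' := ⟨0, 1, by simp⟩
  neg_mem' := by
    rintro ⟨f, k⟩ ⟨a, b, hb, hf, hk⟩
    exact ⟨-a, b, hb, by simp [← hf], by simp [← hk]⟩
  add_mem' := by
    rintro ⟨f, k⟩ ⟨g, l⟩ ⟨a, b, hb, hf, hk⟩ ⟨c, d, hd, hg, hl⟩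
    refine ⟨a * d + c * b, b * d, by simp [hb, hd], ?_, ?_⟩
    · simp only [Prod.fst_add, map_mul, map_add, ← hf, ← hg]
      ring
    · simp only [Prod.snd_add, map_mul, map_add, ← hk, ← hl]
      ring
  mul_mem' := by
    rintro ⟨f, k⟩ ⟨g, l⟩ ⟨a, b, hb, hf, hk⟩ ⟨c, d, hd, hg, hl⟩
    refine ⟨a * c, b * d, by simp [hb, hd], ?_, ?_⟩
    · simp only [Prod.fst_mul, map_mul, ← hf, ← hg]
      ring
    · simp only [Prod.snd_mul, map_mul, ← hk, ← hl]
      ring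

/-- The element `f` of `F` specializes to `k` under `φ`: it is a fraction of elements of `A` whose
denominator is not in the kernel of `φ`, and `k` is the value of this fraction. -/
def IsSpecialization (φ : A →+* K) (f : F) (k : K) : Prop :=
  (f, k) ∈ specializationSubring F φ

namespace IsSpecialization

variable {φ : A →+* K} {f g : F} {k l : K}

theorem of_algebraMap (φ : A →+* K) (a : A) : IsSpecialization φ (algebraMap A F a) (φ a) :=
  ⟨a, 1, by simp⟩

theorem one : IsSpecialization φ (1 : F) 1 :=
  one_mem (specializationSubring F φ)

theorem mul (hf : IsSpecialization φ f k) (hg : IsSpecialization φ g l) :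
    IsSpecialization φ (f * g) (k * l) :=
  mul_mem (S := Subring (F × K)) hf hg

theorem neg (hf : IsSpecialization φ f k) : IsSpecialization φ (-f) (-k) :=
  neg_mem (S := Subring (F × K)) hf

theorem sub (hf : IsSpecialization φ f k) (hg : IsSpecialization φ g l) :
    IsSpecialization φ (f - g) (k - l) :=
  sub_mem (S := Subring (F × K)) hf hg

theorem pow (hf : IsSpecialization φ f k) (m : ℕ) : IsSpecialization φ (f ^ m) (k ^ m) :=
  pow_mem (M := F × K) (A := Subring (F × K)) hf m

theorem prod {ι : Type*} (s : Finset ι) {f : ι → F} {k : ι → K}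
    (h : ∀ i ∈ s, IsSpecialization φ (f i) (k i)) :
    IsSpecialization φ (∏ i ∈ s, f i) (∏ i ∈ s, k i) := by
  rw [IsSpecialization, prod_mk_prod]
  exact prod_mem h

theorem sum {ι : Type*} (s : Finset ι) {f : ι → F} {k : ι → K}
    (h : ∀ i ∈ s, IsSpecialization φ (f i) (k i)) :
    IsSpecialization φ (∑ i ∈ s, f i) (∑ i ∈ s, k i) := by
  rw [IsSpecialization, prod_mk_sum]
  exact sum_mem h

variable [FaithfulSMul A F]

theorem inv (hf : IsSpecialization φ f k) (hk : k ≠ 0) : IsSpecialization φ f⁻¹ k⁻¹ := by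
  obtain ⟨a, b, hb, hfa, hka⟩ := hf
  have ha : φ a ≠ 0 := hka ▸ mul_ne_zero hk hb
  have hf0 : f ≠ 0 := by
    rintro rfl
    rw [zero_mul, eq_comm, FaithfulSMul.algebraMap_eq_zero_iff] at hfa
    exact ha (by rw [hfa, map_zero])
  exact ⟨b, a, ha, by simp [← hfa, hf0], by simp [← hka, hk]⟩

theorem div (hf : IsSpecialization φ f k) (hg : IsSpecialization φ g l) (hl : l ≠ 0) :
    IsSpecialization φ (f / g) (k / l) := by
  simpa only [div_eq_mul_inv] using hf.mul (hg.inv hl)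

theorem zpow (hf : IsSpecialization φ f k) (hk : k ≠ 0) (d : ℤ) :
    IsSpecialization φ (f ^ d) (k ^ d) := by
  obtain ⟨m, rfl | rfl⟩ := d.eq_nat_or_neg
  · simpa using hf.pow m
  · simpa using (hf.pow m).inv (pow_ne_zero m hk)

theorem unique (hf : IsSpecialization φ f k) (hg : IsSpecialization φ f l) : k = l := by
  obtain ⟨a, b, hb, hfa, hka⟩ := hf
  obtain ⟨c, d, hd, hfc, hlc⟩ := hg
  have had : a * d = c * b := by
    apply FaithfulSMul.algebraMap_injective A F
    simp only [map_mul]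
    linear_combination algebraMap A F b * hfc - algebraMap A F d * hfa
  have hφ : φ a * φ d = φ c * φ b := by rw [← map_mul, had, map_mul]
  apply mul_right_cancel₀ (mul_ne_zero hb hd)
  linear_combination hφ + φ d * hka - φ b * hlc

end IsSpecialization

end Specialization

section SpecializationOfFormulas

variable {A F K : Type*} [CommRing A] [Field F] [Algebra A F] [Field K] {φ : A →+* K}

theorem IsSpecialization.qPoch {f g : F} {k l : K} (hf : IsSpecialization φ f k)
    (hg : IsSpecialization φ g l) (m : ℕ) : IsSpecialization φ (qPoch f g m) (qPoch k l m) :=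
  .prod _ fun i _ ↦ one.sub (hf.mul (hg.pow i))

variable [FaithfulSMul A F] {n : ℕ} {x' : Fin n → F} {z' q' w' : F} {x : Fin n → K} {z q w : K}

theorem IsSpecialization.signSum (r : ℕ) (sx : ∀ i, IsSpecialization φ (x' i) (x i))
    (sz : IsSpecialization φ z' z) (sq : IsSpecialization φ q' q)
    (hx : ∀ i, x i ≠ 0) (hx_sq : ∀ i, x i ^ 2 ≠ 1) (hx_mul : ∀ i j, i < j → x i * x j ≠ 1)
    (hx_ne : ∀ i j, i < j → x i ≠ x j) (hzx_mul : ∀ i, z * x i ≠ 1) (hzx_ne : ∀ i, z ≠ x i) :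
    IsSpecialization φ (signSum r x' z' q') (signSum r x z q) := by
  have sx (i) (d : ℤ) : IsSpecialization φ (x' i ^ d) (x i ^ d) := (sx i).zpow (hx i) d
  refine .sum _ fun σ _ ↦ .mul (.prod _ fun i _ ↦ ?_) (.prod _ fun i _ ↦ .prod _ fun j hj ↦ ?_)
  · refine .mul (.div (.sub .one (sq.mul (sx i _))) (.sub .one (sx i _)) ?_)
      (.div (.sub .one (((sq.pow r).mul sz).mul (sx i _))) (.sub .one (sz.mul (sx i _))) ?_)
    · rw [sub_ne_zero, ne_comm, mul_comm, zpow_mul, zpow_ofNat]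
      rcases Int.units_eq_one_or (σ i) with e | e
      · simpa only [e, Units.val_one, zpow_one] using hx_sq i
      · simpa only [e, Units.val_neg, Units.val_one, zpow_neg_one, inv_pow, ne_eq, inv_eq_one]
          using hx_sq i
    · rw [sub_ne_zero, ne_comm]
      rcases Int.units_eq_one_or (σ i) with e | e
      · simpa [e, mul_inv_eq_one₀ (hx i)] using hzx_ne i
      · simpa [e] using hzx_mul i
  · refine .div (.sub .one ((sq.mul (sx i _)).mul (sx j _))) (.sub .one ((sx i _).mul (sx j _))) ?_
    have hij := mem_Ioi.1 hj
    rw [sub_ne_zero, ne_comm]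
    rcases Int.units_eq_one_or (σ i) with e | e <;> rcases Int.units_eq_one_or (σ j) with e' | e'
    · simpa [e, e'] using hx_mul i j hij
    · simpa [e, e', mul_inv_eq_one₀ (hx j)] using hx_ne i j hij
    · simpa [e, e', inv_mul_eq_one₀ (hx i)] using hx_ne i j hij
    · simpa [e, e', ← mul_inv, -mul_inv_rev] using hx_mul i j hij

theorem IsSpecialization.qHypTerm {r m : ℕ} (sx : ∀ i, IsSpecialization φ (x' i) (x i))
    (sz : IsSpecialization φ z' z) (sq : IsSpecialization φ q' q) (sw : IsSpecialization φ w' w)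
    (hq : q ≠ 0) (hx : ∀ i, x i ≠ 0) (hqq : _root_.qPoch q q m ≠ 0)
    (hlow : ∀ i, _root_.qPoch (lowerParams r x z q i) q m ≠ 0) :
    IsSpecialization φ (qHypTerm (upperParams r x' z' q') (lowerParams r x' z' q') q' w' m)
      (qHypTerm (upperParams r x z q) (lowerParams r x z q) q w m) := by
  refine .mul (.div ?_ ?_ (prod_ne_zero_iff.2 fun i _ ↦ hlow i))
    (.div (sw.pow m) (sq.qPoch sq m) hqq)
  · rw [prod_upperParams _ _ _ _ (_root_.qPoch · q' m),
      prod_upperParams _ _ _ _ (_root_.qPoch · q m)]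
    exact .mul (.qPoch (sz.pow 2) sq m) <| .mul (.qPoch (sq.mul sz) sq m) <|
      .mul (.qPoch (sq.mul sz).neg sq m) <| .mul (.qPoch (sq.zpow hq _) sq m) <|
      .mul (.prod _ fun i _ ↦ .qPoch ((sq.mul sz).mul (sx i)) sq m)
        (.prod _ fun i _ ↦ .qPoch ((sq.mul sz).div (sx i) (hx i)) sq m)
  · rw [prod_lowerParams _ _ _ _ (_root_.qPoch · q' m),
      prod_lowerParams _ _ _ _ (_root_.qPoch · q m)]
    exact .mul (.qPoch sz sq m) <| .mul (.qPoch sz.neg sq m) <|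
      .mul (.qPoch ((sq.pow _).mul (sz.pow 2)) sq m) <|
      .mul (.prod _ fun i _ ↦ .qPoch (sz.div (sx i) (hx i)) sq m)
        (.prod _ fun i _ ↦ .qPoch (sz.mul (sx i)) sq m)

theorem IsSpecialization.prefactor {r : ℕ} (sz : IsSpecialization φ z' z)
    (sq : IsSpecialization φ q' q) (hq : q ≠ 0) (hneg : ∀ k : ℕ, n + k < r → 1 + q ^ k ≠ 0)
    (hpre : _root_.qPoch (q * z ^ 2) q r ≠ 0) :
    IsSpecialization φ (prefactor q' z' n r) (prefactor q z n r) := by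
  refine .mul (.mul (sq.zpow hq _) ?_) (.div (.qPoch (sq.mul (sz.pow 2)) (sq.pow 2) r)
    (.qPoch (sq.mul (sz.pow 2)) sq r) hpre)
  rcases hd : (n : ℤ) - r with k | k
  · exact .qPoch sq.neg sq k
  · refine .inv (.qPoch (sq.neg.mul (sq.zpow hq _)) sq _) (qPoch_ne_zero fun i hi e ↦ ?_)
    rw [Int.negSucc_eq] at hd
    have hfactor : -q * q ^ (-((k : ℤ) + 1)) * q ^ i * q ^ (k - i) = -1 := by
      rw [mul_assoc, ← pow_add, Nat.add_sub_cancel' (by lia), zpow_neg, zpow_add_one₀ hq,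
        zpow_natCast]
      field_simp
    rw [e] at hfactor
    exact hneg (k - i) (by lia) (by linear_combination hfactor)

end SpecializationOfFormulas

section GenericPoint

open MvPolynomial

theorem algebraMap_ne_of_eval_ne {ι R : Type*} [CommRing R] [IsDomain R] {p p' : MvPolynomial ι R}
    (v : ι → R) (h : eval v p ≠ eval v p') :
    algebraMap _ (FractionRing (MvPolynomial ι R)) p ≠ algebraMap _ _ p' :=
  fun e ↦ h (congrArg (eval v) (IsFractionRing.injective _ _ e))

variable {n : ℕ}

/-- The indeterminates as elements of the field of rational functions: `Sum.inl i` stands for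
`x_i`, `Sum.inr 0` for `q` and `Sum.inr 1` for `z`. -/
noncomputable def genericVar (i : Fin n ⊕ Fin 2) :
    FractionRing (MvPolynomial (Fin n ⊕ Fin 2) ℤ) :=
  algebraMap (MvPolynomial (Fin n ⊕ Fin 2) ℤ) _ (X i)

theorem signRegular_genericVar (k : ℕ) :
    SignRegular (vecCons (genericVar (Sum.inr 1) * genericVar (Sum.inr 0) ^ k)
      fun i : Fin n ↦ genericVar (Sum.inl i)) := by
  let m : Fin (n + 1) → MvPolynomial (Fin n ⊕ Fin 2) ℤ :=
    vecCons (X (Sum.inr 1) * X (Sum.inr 0) ^ k) fun i ↦ X (Sum.inl i)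
  have hm : vecCons (genericVar (Sum.inr 1) * genericVar (Sum.inr 0) ^ k)
      (fun i : Fin n ↦ genericVar (Sum.inl i)) = fun i ↦ algebraMap _ _ (m i) := by
    ext i
    cases i using Fin.cases <;> simp [m, genericVar]
  have hzero (i) : constantCoeff (m i) = 0 := by cases i using Fin.cases <;> simp [m]
  have hone (i) : eval 1 (m i) = 1 := by cases i using Fin.cases <;> simp [m]
  rw [hm]
  refine ⟨fun i ↦ ?_, fun i ↦ ?_, fun i j _ ↦ ?_, ?_⟩
  · simpa using algebraMap_ne_of_eval_ne (p := m i) (p' := 0) 1 (by simp [hone])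
  · have := algebraMap_ne_of_eval_ne (p := m i ^ 2) (p' := 1) 0 (by simp [hzero])
    simpa only [map_pow, map_one] using this
  · have := algebraMap_ne_of_eval_ne (p := m i * m j) (p' := 1) 0 (by simp [hzero])
    simpa only [map_mul, map_one] using this
  · refine Function.Injective.of_lt_imp_ne fun i j hij ↦ ?_
    obtain ⟨j, rfl⟩ := Fin.exists_succ_eq.2 (Fin.ne_zero_of_lt hij)
    refine algebraMap_ne_of_eval_ne (Pi.single (Sum.inl j) 1) ?_
    cases i using Fin.cases with
    | zero => simp [m]
    | succ i => simpa [m, Pi.single_apply] using (Fin.succ_lt_succ_iff.1 hij).ne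

theorem isGeneric_genericVar :
    IsGeneric (genericVar (n := n) (Sum.inr 0)) (genericVar (Sum.inr 1))
      (fun i ↦ genericVar (Sum.inl i)) where
  q_ne_zero := by simp [genericVar]
  one_add_pow_ne_zero k := by
    have := algebraMap_ne_of_eval_ne (ι := Fin n ⊕ Fin 2) (R := ℤ)
      (p := 1 + X (Sum.inr 0) ^ k) (p' := 0) 1 (by simp)
    simpa only [genericVar, map_add, map_one, map_pow, map_zero] using this
  pow_ne_one k := by
    have := algebraMap_ne_of_eval_ne (ι := Fin n ⊕ Fin 2) (R := ℤ)
      (p := X (Sum.inr 0) ^ (k + 1)) (p' := 1) 0 (by simp)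
    simpa only [genericVar, map_pow, map_one] using this
  sq_mul_pow_ne_one k := by
    have := algebraMap_ne_of_eval_ne (ι := Fin n ⊕ Fin 2) (R := ℤ)
      (p := X (Sum.inr 1) ^ 2 * X (Sum.inr 0) ^ k) (p' := 1) 0 (by simp)
    simpa only [genericVar, map_mul, map_pow, map_one] using this
  signRegular := signRegular_genericVar

end GenericPoint

theorem signSum_eq_sum {K : Type*} [Field K] {n r : ℕ} {x : Fin n → K} {z q : K}
    (hq : q ≠ 0) (hx : ∀ i, x i ≠ 0)
    (hx_sq : ∀ i, x i ^ 2 ≠ 1)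
    (hx_mul : ∀ i j, i < j → x i * x j ≠ 1)
    (hx_ne : ∀ i j, i < j → x i ≠ x j)
    (hzx_mul : ∀ i, z * x i ≠ 1)
    (hzx_ne : ∀ i, z ≠ x i)
    (hneg : ∀ k : ℕ, n + k < r → 1 + q ^ k ≠ 0)
    (hpre : qPoch (q * z ^ 2) q r ≠ 0)
    (hqq : qPoch q q r ≠ 0)
    (hlow : ∀ i, qPoch (lowerParams r x z q i) q r ≠ 0) :
    signSum r x z q = prefactor q z n r * ∑ m ∈ range (r + 1),
      qHypTerm (upperParams r x z q) (lowerParams r x z q) q (-q ^ ((r : ℤ) - (n : ℤ))) m := by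
  let φ : MvPolynomial (Fin n ⊕ Fin 2) ℤ →+* K :=
    MvPolynomial.eval₂Hom (Int.castRingHom K) (Sum.elim x ![q, z])
  have svar (i) : IsSpecialization φ (genericVar i) (Sum.elim x ![q, z] i) := by
    simpa only [φ, MvPolynomial.eval₂Hom_X'] using! IsSpecialization.of_algebraMap φ
      (MvPolynomial.X i)
  have sx (i : Fin n) : IsSpecialization φ (genericVar (Sum.inl i)) (x i) := svar (Sum.inl i)
  have sq : IsSpecialization φ (genericVar (Sum.inr 0)) q := svar (Sum.inr 0)
  have sz : IsSpecialization φ (genericVar (Sum.inr 1)) z := svar (Sum.inr 1)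
  have hl := IsSpecialization.signSum r sx sz sq hx hx_sq hx_mul hx_ne hzx_mul hzx_ne
  rw [isGeneric_genericVar.signSum_eq_sum] at hl
  refine hl.unique (.mul (.prefactor sz sq hq hneg hpre) (.sum _ fun m hm ↦ ?_))
  have hmr : m ≤ r := Nat.lt_succ_iff.1 (mem_range.1 hm)
  exact .qHypTerm sx sz sq (sq.zpow hq _).neg hq hx (qPoch_ne_zero_of_le hmr hqq)
    fun i ↦ qPoch_ne_zero_of_le hmr (hlow i)

/-- The hypotheses say that `q` and the `x_i` are invertible and that none of the denominators
in the identity vanishes: first those of the sum over signs, then those of the prefactor, then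
those of the terms `0, …, r` of the terminating series. -/
theorem theorem8 {K : Type*} [Field K] [TopologicalSpace K] (n r : ℕ) (x : Fin n → K) (z q : K)
    (hq : q ≠ 0) (hx : ∀ i, x i ≠ 0)
    (hx_sq : ∀ i, x i ^ 2 ≠ 1)
    (hx_mul : ∀ i j, i < j → x i * x j ≠ 1)
    (hx_ne : ∀ i j, i < j → x i ≠ x j)
    (hzx_mul : ∀ i, z * x i ≠ 1)
    (hzx_ne : ∀ i, z ≠ x i)
    (hneg : ∀ k : ℕ, n + k < r → 1 + q ^ k ≠ 0)
    (hpre : qPoch (q * z ^ 2) q r ≠ 0)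
    (hqq : qPoch q q r ≠ 0)
    (hlow : ∀ i, qPoch (lowerParams r x z q i) q r ≠ 0) :
    IsVeryWellPoised (upperParams r x z q) (lowerParams r x z q) q ∧
    (∀ m : ℕ, r < m →
      qHypTerm (upperParams r x z q) (lowerParams r x z q) q (-q ^ ((r : ℤ) - (n : ℤ))) m = 0) ∧
    signSum r x z q =
      q ^ ((n : ℤ) * (r : ℤ) - (r.choose 2 : ℤ)) * qPochInt (-q) q ((n : ℤ) - (r : ℤ)) *
        (qPoch (q * z ^ 2) (q ^ 2) r / qPoch (q * z ^ 2) q r) *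
        qHyp (upperParams r x z q) (lowerParams r x z q) q (-q ^ ((r : ℤ) - (n : ℤ))) := by
  have hzero (m : ℕ) (hm : r < m) :
      qHypTerm (upperParams r x z q) (lowerParams r x z q) q (-q ^ ((r : ℤ) - (n : ℤ))) m = 0 :=
    qHypTerm_params_eq_zero x z _ hq hm
  refine ⟨isVeryWellPoised_params r hq hx, hzero, ?_⟩
  rw [signSum_eq_sum hq hx hx_sq hx_mul hx_ne hzx_mul hzx_ne hneg hpre hqq hlow, qHyp, prefactor,
    tsum_eq_sum (s := range (r + 1)) fun m hm ↦ hzero m (by simpa using hm)]
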